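/- \textbf{ACD computation.} Let $G=(V,E)$ be a graph with $n$ nodes and maximum degree $\Delta$. For $\gamma>0$, nodes $u,v$ are \emph{$\gamma$-friends} if $\{u,v\}\in E$ and $|N(u)\cap N(v)|\ge(1-\gamma)\Delta$; a node is \emph{$\gamma$-dense} if it has at least $(1-\gamma)\Delta$ $\gamma$-friends. A partition $V=V_{sparse}\cup C_1\cup\dots\cup C_k$ is an \emph{$(\varepsilon,\eta)$-almost-clique decomposition} (ACD) of $G$ if (1) $V_{sparse}$ contains no $\eta$-dense node; (2) $(1-\varepsilon)\Delta\le|C_i|\le(1+\varepsilon)\Delta$ for every $i$; (3) $|N(v)\cap C_i|\ge(1-\varepsilon)\Delta$ for every $i$ and every $v\in C_i$. An algorithm \emph{computes} an ACD if, at its end, every node of $V_{sparse}$ knows that it is in $V_{sparse}$, and every node of $C_i$ knows an AC-ID of $C_i$, where distinct $C_i$ have distinct AC-IDs. In the CONGEST model, the nodes of $G$ have distinct identifiers smaller than $n^{a}$, for a constant $a$. Each node initially knows $n$, $\Delta$, its identifier and its degree, and has private independent random bits. Computation proceeds in synchronous rounds. In each round every node may send a message of $O(\log n)$ bits (with a constant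 that may depend on $a$) over each of its incident edges, and local computation is free. \textbf{Lemma.} Let $\varepsilon=1/3$ and $\eta=\varepsilon/108$. There is an absolute constant $T$ such that for every $a$ there is a randomized $T$-round CONGEST algorithm with the following property. For every constant $\kappa\ge1$ there is a constant $c>0$ such that, on every $n$-node graph $G$ with maximum degree $\Delta\ge c\log^2 n$, the algorithm computes an $(\varepsilon,\eta)$-almost-clique decomposition of $G$ with probability at least $1-n^{-\kappa}$. -/

import Mathlib

open Finset

/-! ### Almost-clique decompositions -/

section AlmostCliques

variable {V : Type} [Fintype V] [DecidableEq V] (G : SimpleGraph V) [DecidableRel G.Adj]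

/-- `u` and `v` are `ε`-similar: they have at least `(1 - ε)Δ` common neighbours. -/
def IsSimilar (ε : ℝ) (u v : V) : Prop :=
  (1 - ε) * (G.maxDegree : ℝ) ≤ ((G.neighborFinset u ∩ G.neighborFinset v).card : ℝ)

/-- `u` and `v` are `ε`-friends: adjacent and `ε`-similar. -/
def IsFriend (ε : ℝ) (u v : V) : Prop :=
  G.Adj u v ∧ IsSimilar G ε u v

open Classical in
/-- `u` is `ε`-dense: it has at least `(1 - ε)Δ` `ε`-friends. -/
def IsDense (ε : ℝ) (u : V) : Prop :=
  (1 - ε) * (G.maxDegree : ℝ) ≤ ((univ.filter fun v => IsFriend G ε u v).card : ℝ)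

/-- `V = sparse ∪ C 0 ∪ ⋯ ∪ C (k - 1)` is an `(ε, η)`-almost-clique decomposition of `G`. -/
structure IsACD (ε η : ℝ) (sparse : Finset V) {k : ℕ} (C : Fin k → Finset V) : Prop where
  cover : ∀ v, v ∈ sparse ∨ ∃ i, v ∈ C i
  disjoint_sparse : ∀ i, Disjoint sparse (C i)
  disjoint : ∀ i j, i ≠ j → Disjoint (C i) (C j)
  not_dense : ∀ v ∈ sparse, ¬ IsDense G η v
  le_card : ∀ i, (1 - ε) * (G.maxDegree : ℝ) ≤ ((C i).card : ℝ)
  card_le : ∀ i, ((C i).card : ℝ) ≤ (1 + ε) * (G.maxDegree : ℝ)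
  le_card_neighbors : ∀ i, ∀ v ∈ C i,
    (1 - ε) * (G.maxDegree : ℝ) ≤ ((G.neighborFinset v ∩ C i).card : ℝ)

/-- The node outputs `out` describe an `(ε, η)`-almost-clique decomposition: a node of the sparse
part outputs `none`, and a node of `C i` outputs `some` of the AC-ID of `C i`, where distinct
almost-cliques have distinct AC-IDs. -/
def OutputsACD (ε η : ℝ) (out : V → Option ℕ) : Prop :=
  ∃ (sparse : Finset V) (k : ℕ) (C : Fin k → Finset V) (acId : Fin k → ℕ),
    IsACD G ε η sparse C ∧ Function.Injective acId ∧
    (∀ v ∈ sparse, out v = none) ∧ (∀ i, ∀ v ∈ C i, out v = some (acId i))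

end AlmostCliques

/-! ### Synchronous message passing -/

/-- How a network presents itself to its nodes: distinct identifiers below `idBound`, and an
arbitrary numbering by `0, …, deg v - 1` of the edges at each node `v` (its ports). -/
structure Labelling {V : Type} [Fintype V] [DecidableEq V] (G : SimpleGraph V)
    [DecidableRel G.Adj] (idBound : ℕ) where
  ident : V → ℕ
  ident_injective : Function.Injective ident
  ident_lt : ∀ v, ident v < idBound
  port : ∀ v, G.neighborSet v ≃ Fin (G.degree v)

/-- A randomized distributed algorithm, the same at every node. A node starts from the number of
nodes `n`, the maximum degree `Δ`, its own identifier, its own degree, and `numBits n Δ` private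
random bits. In each round it sends a bit string through each of its ports (the empty string means
that nothing is sent), and updates its state from the strings that arrive on its ports.
Local computation is unrestricted. -/
structure DistAlgorithm where
  State : Type
  numBits : ℕ → ℕ → ℕ
  init : (n Δ ident degree : ℕ) → (Fin (numBits n Δ) → Bool) → State
  send : State → (port : ℕ) → List Bool
  receive : State → (port : ℕ → List Bool) → State
  output : State → Option ℕ

namespace DistAlgorithm

variable (A : DistAlgorithm) {V : Type} [Fintype V] [DecidableEq V] (G : SimpleGraph V)
  [DecidableRel G.Adj]

/-- The private random bits of all the nodes. -/
abbrev Coins : Type :=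
  V → Fin (A.numBits (Fintype.card V) G.maxDegree) → Bool

variable {G} {idBound : ℕ} (L : Labelling G idBound)

/-- What node `v` receives, by port, when all nodes send according to the states `s`. -/
def inbox (s : V → A.State) (v : V) (p : ℕ) : List Bool :=
  if h : p < G.degree v then
    let u := (L.port v).symm ⟨p, h⟩
    A.send (s u.1) (L.port u.1 ⟨v, G.adj_symm u.2⟩)
  else []

/-- The states of all nodes after `t` rounds, as a function of the random bits. -/
def run (ω : A.Coins G) : ℕ → V → A.State
  | 0 => fun v => A.init (Fintype.card V) G.maxDegree (L.ident v) (G.degree v) (ω v)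
  | t + 1 => fun v => A.receive (run ω t v) (A.inbox L (run ω t) v)

/-- The probability, over independent fair random bits, that the outputs after `T` rounds
satisfy `P`. -/
noncomputable def outputProb (T : ℕ) (P : (V → Option ℕ) → Prop) : ℝ :=
  (ProbabilityTheory.uniformOn (Set.univ : Set (A.Coins G))).real
    {ω | P fun v => A.output (A.run L ω T v)}

/-- The CONGEST restriction, for `T` rounds in networks whose identifiers are below `n ^ a`:
in every execution, every message has at most `B * ⌈log₂ n⌉` bits. -/
def IsCongest (T a B : ℕ) : Prop :=
  ∀ (V : Type) [Fintype V] [DecidableEq V] (G : SimpleGraph V) [DecidableRel G.Adj]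
    (L : Labelling G (Fintype.card V ^ a)) (ω : A.Coins G) (t : ℕ) (v : V)
    (p : Fin (G.degree v)), t < T →
      (A.send (A.run L ω t v) p).length ≤ B * Nat.clog 2 (Fintype.card V)

end DistAlgorithm

/-!
Every vertex becomes a leader with probability about `1 / √Δ`, and votes for a random one of its
adjacent leaders, each of which it picks with the same probability `1 / numSlots Δ`. The number of
votes that a leader `l` gets from the neighbours of `u` then estimates the number of common
neighbours of `u` and `l`. The estimates are off by at most `δ * Δ`, and every dense vertex has a
leader among its friends, up to a probability that is exponentially small in `√Δ`, hence
polynomially small in the number of vertices.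

Call a leader active if almost all of its neighbours seem to share almost all neighbours with it,
that is, are close to it. Two active leaders that share more than half of their neighbours have a
vertex close to both, so they share almost all of their neighbours. Hence being similar is
transitive among active leaders. The vertices close to the leaders of one similarity class form an
almost-clique, labelled by the least identifier in the class.
-/

section Similarity

variable {V : Type} [Fintype V] [DecidableEq V] {G : SimpleGraph V} [DecidableRel G.Adj]

lemma le_card_inter_of_subset_neighborFinset {a b : ℝ} {v : V} {A B : Finset V}
    (hA : A ⊆ G.neighborFinset v) (hB : B ⊆ G.neighborFinset v)
    (ha : (1 - a) * G.maxDegree ≤ (#A : ℝ)) (hb : (1 - b) * G.maxDegree ≤ (#B : ℝ)) :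
    (1 - (a + b)) * G.maxDegree ≤ (#(A ∩ B) : ℝ) := by
  have h_union : (#(A ∪ B) : ℝ) ≤ G.maxDegree := by
    exact_mod_cast (card_le_card (union_subset hA hB)).trans (G.degree_le_maxDegree v)
  have h_add : (#(A ∪ B) : ℝ) + #(A ∩ B) = #A + #B := by
    exact_mod_cast card_union_add_card_inter A B
  linarith

namespace IsSimilar

variable {a b : ℝ} {u v w : V}

lemma symm (h : IsSimilar G a u v) : IsSimilar G a v u := by
  rwa [IsSimilar, inter_comm]

lemma mono (h : IsSimilar G a u v) (hab : a ≤ b) : IsSimilar G b u v :=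
  (mul_le_mul_of_nonneg_right (by linarith) (Nat.cast_nonneg _)).trans h

lemma trans (huv : IsSimilar G a u v) (hvw : IsSimilar G b v w) : IsSimilar G (a + b) u w := by
  refine (le_card_inter_of_subset_neighborFinset inter_subset_right inter_subset_left
    huv hvw).trans (Nat.cast_le.2 (card_le_card ?_))
  exact inter_subset_inter inter_subset_left inter_subset_right

end IsSimilar

/-- Count the edges between `C` and the neighbourhood of `v`. -/
lemma card_mul_le_of_forall_isSimilar {ε : ℝ} {v : V} {C : Finset V} (hΔ : 0 < G.maxDegree)
    (h : ∀ u ∈ C, IsSimilar G ε u v) : #C * (1 - ε) ≤ G.maxDegree := by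
  have h_edges : ∑ u ∈ C, #(G.neighborFinset u ∩ G.neighborFinset v)
      ≤ G.maxDegree * G.maxDegree := calc
    _ = ∑ u ∈ C, #((G.neighborFinset v).bipartiteAbove G.Adj u) := by
        refine sum_congr rfl fun u _ ↦ congrArg card ?_
        ext w
        simp [bipartiteAbove, and_comm]
    _ = ∑ w ∈ G.neighborFinset v, #(C.bipartiteBelow G.Adj w) :=
        sum_card_bipartiteAbove_eq_sum_card_bipartiteBelow _
    _ ≤ ∑ _w ∈ G.neighborFinset v, G.maxDegree := by
        refine sum_le_sum fun w _ ↦ (card_le_card fun u hu ↦ ?_).trans (G.degree_le_maxDegree w)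
        exact (G.mem_neighborFinset w u).2 (mem_bipartiteBelow _ |>.1 hu).2.symm
    _ ≤ G.maxDegree * G.maxDegree := by
        rw [sum_const, smul_eq_mul]
        exact Nat.mul_le_mul_right _ (G.degree_le_maxDegree v)
  refine le_of_mul_le_mul_right ?_ (Nat.cast_pos.2 hΔ : (0 : ℝ) < G.maxDegree)
  calc #C * (1 - ε) * G.maxDegree = ∑ _u ∈ C, (1 - ε) * G.maxDegree := by
        rw [sum_const, nsmul_eq_mul, mul_assoc]
    _ ≤ ∑ u ∈ C, (#(G.neighborFinset u ∩ G.neighborFinset v) : ℝ) := sum_le_sum h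
    _ ≤ G.maxDegree * G.maxDegree := by exact_mod_cast h_edges

/-- The almost-cliques are the fibres of the output map. -/
lemma outputsACD_of_forall {ε η : ℝ} {out : V → Option ℕ}
    (not_dense : ∀ v, out v = none → ¬ IsDense G η v)
    (card_fibre_le : ∀ v, out v ≠ none → (#{w | out w = out v} : ℝ) ≤ (1 + ε) * G.maxDegree)
    (le_card_fibre : ∀ v, out v ≠ none →
      (1 - ε) * G.maxDegree ≤ (#{w ∈ G.neighborFinset v | out w = out v} : ℝ)) :
    OutputsACD G ε η out := by
  let ids : Finset ℕ := (univ.image out).eraseNone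
  let acId (i : Fin #ids) : ℕ := ids.equivFin.symm i
  have acId_injective : Function.Injective acId :=
    Subtype.val_injective.comp ids.equivFin.symm.injective
  let C (i : Fin #ids) : Finset V := {w | out w = some (acId i)}
  have exists_rep (i) : ∃ v, out v = some (acId i) := by
    have h_mem : acId i ∈ ids := (ids.equivFin.symm i).2
    simpa only [ids, mem_eraseNone, mem_image, mem_univ, true_and] using h_mem
  have mem_C {v i} (hv : v ∈ C i) : out v = some (acId i) := (mem_filter.1 hv).2
  have C_eq {v i} (hv : out v = some (acId i)) :
      out v ≠ none ∧ C i = univ.filter (out · = out v) := by simp [C, hv]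
  refine ⟨univ.filter (out · = none), #ids, C, acId, ?_, acId_injective, by simp, fun _ _ ↦ mem_C⟩
  refine ⟨fun v ↦ ?_, fun i ↦ ?_, fun i j hij ↦ ?_, by simpa using not_dense, fun i ↦ ?_,
    fun i ↦ ?_, fun i v hv ↦ ?_⟩
  · cases hv : out v with
    | none => exact .inl (by simpa using hv)
    | some x =>
      have hx : x ∈ ids := mem_eraseNone.2 (hv ▸ mem_image_of_mem out (mem_univ v))
      exact .inr ⟨ids.equivFin ⟨x, hx⟩, by simp [C, acId, hv]⟩
  · refine disjoint_left.2 fun v hv hvi ↦ ?_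
    simp [mem_C hvi] at hv
  · refine disjoint_left.2 fun v hvi hvj ↦ hij (acId_injective ?_)
    exact Option.some_injective _ ((mem_C hvi).symm.trans (mem_C hvj))
  · obtain ⟨v, hv⟩ := exists_rep i
    obtain ⟨hne, hC⟩ := C_eq hv
    rw [hC]
    exact (le_card_fibre v hne).trans
      (Nat.cast_le.2 (card_le_card (filter_subset_filter _ (subset_univ _))))
  · obtain ⟨v, hv⟩ := exists_rep i
    obtain ⟨hne, hC⟩ := C_eq hv
    exact hC ▸ card_fibre_le v hne
  · obtain ⟨hne, hC⟩ := C_eq (mem_C hv)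
    rw [hC, inter_filter, inter_univ]
    exact le_card_fibre v hne

end Similarity

section Clustering

variable {V : Type} [Fintype V] [DecidableEq V] (G : SimpleGraph V) [DecidableRel G.Adj]

/-- With `est u l` an estimate of the number of common neighbours of `u` and `l`: the vertex `u`
looks `3δ`-similar to the leader `l`. -/
def IsClose (δ : ℝ) (est : V → V → ℝ) (u l : V) : Prop :=
  (1 - 3 * δ) * G.maxDegree ≤ est u l

open Classical in
/-- A leader is active, and will head an almost-clique, if most of its neighbours are close
to it. -/
def IsActive (δ : ℝ) (lead : V → Prop) (est : V → V → ℝ) (l : V) : Prop :=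
  lead l ∧ (1 - 2 * δ) * G.maxDegree ≤ (#{u ∈ G.neighborFinset l | IsClose G δ est u l} : ℝ)

/-- The event of the analysis under which the clustering around active leaders is an almost-clique
decomposition: common neighbourhoods with leaders are estimated up to an error `δΔ`, and every
dense vertex has a leader among its friends. -/
structure GoodEstimates (δ : ℝ) (lead : V → Prop) (est : V → V → ℝ) : Prop where
  abs_sub_le : ∀ u l, lead l →
    |est u l - #(G.neighborFinset u ∩ G.neighborFinset l)| ≤ δ * G.maxDegree
  exists_leader : ∀ u, IsDense G δ u → ∃ l, lead l ∧ IsFriend G δ u l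

open Classical in
/-- The label of a vertex in the clustering around active leaders. Every vertex close to an active
leader takes the least identifier among the active leaders of its cluster; these it recognizes as
the ones with which it appears to share at least `Δ / 2` neighbours. -/
noncomputable def clusterLabel (δ : ℝ) (lead : V → Prop) (est : V → V → ℝ) (ident : V → ℕ)
    (v : V) : Option ℕ :=
  if ∃ l, IsActive G δ lead est l ∧ IsClose G δ est v l then
    some (sInf (ident '' {l | IsActive G δ lead est l ∧ (G.maxDegree : ℝ) / 2 ≤ est v l}))
  else none

variable {G} {δ : ℝ} {lead : V → Prop} {est : V → V → ℝ} {u v l m : V}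

lemma IsActive.isSimilar_self (hl : IsActive G δ lead est l) : IsSimilar G (2 * δ) l l := by
  classical
  rw [IsSimilar, inter_self]
  exact hl.2.trans (Nat.cast_le.2 (card_le_card (filter_subset _ _)))

namespace GoodEstimates

lemma isSimilar_of_le (H : GoodEstimates G δ lead est) {a : ℝ} (hl : lead l)
    (h : (1 - a) * G.maxDegree ≤ est u l) : IsSimilar G (a + δ) u l := by
  have := abs_le.1 (H.abs_sub_le u l hl)
  unfold IsSimilar
  linarith

lemma le_of_isSimilar (H : GoodEstimates G δ lead est) {a : ℝ} (hl : lead l)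
    (h : IsSimilar G a u l) : (1 - (a + δ)) * G.maxDegree ≤ est u l := by
  have := abs_le.1 (H.abs_sub_le u l hl)
  unfold IsSimilar at h
  linarith

lemma isSimilar_of_isClose (H : GoodEstimates G δ lead est) (hl : lead l)
    (h : IsClose G δ est u l) : IsSimilar G (4 * δ) u l :=
  (H.isSimilar_of_le hl h).mono (by linarith)

/-- All friends of a dense vertex are close to any leader among them. -/
lemma exists_isActive_isClose (H : GoodEstimates G δ lead est) (hδ : 0 ≤ δ)
    (hu : IsDense G δ u) : ∃ l, IsActive G δ lead est l ∧ IsClose G δ est u l := by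
  classical
  obtain ⟨l, hl, hul⟩ := H.exists_leader u hu
  have isClose_of {w} (h : IsSimilar G (2 * δ) w l) : IsClose G δ est w l :=
    (H.le_of_isSimilar hl h).trans' (by ring_nf; rfl)
  refine ⟨l, ⟨hl, ?_⟩, isClose_of (hul.2.mono (by linarith))⟩
  have h_friends : (1 - (δ + δ)) * G.maxDegree ≤ (#(_ ∩ _) : ℝ) :=
    le_card_inter_of_subset_neighborFinset inter_subset_left
      (fun w hw ↦ (G.mem_neighborFinset u w).2 (mem_filter.1 hw).2.1) hul.2 hu
  rw [two_mul]
  refine h_friends.trans (Nat.cast_le.2 (card_le_card fun w hw ↦ ?_))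
  obtain ⟨hw_nbr, hw_friend⟩ := mem_inter.1 hw
  refine mem_filter.2 ⟨(mem_inter.1 hw_nbr).2, isClose_of ?_⟩
  exact two_mul δ ▸ (mem_filter.1 hw_friend).2.2.symm.trans hul.2

/-- Some vertex is close to both leaders. -/
lemma isSimilar_of_isActive (H : GoodEstimates G δ lead est) (hΔ : 0 < G.maxDegree)
    {a : ℝ} (ha : a < 1 - 4 * δ) (hl : IsActive G δ lead est l) (hm : IsActive G δ lead est m)
    (h : IsSimilar G a l m) : IsSimilar G (8 * δ) l m := by
  classical
  have h_close := le_card_inter_of_subset_neighborFinset inter_subset_left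
    (filter_subset _ _) h hl.2
  have h_both := le_card_inter_of_subset_neighborFinset
    (inter_subset_left.trans inter_subset_right) (filter_subset _ _) h_close hm.2
  have h_pos : (0 : ℝ) < (1 - (a + 2 * δ + 2 * δ)) * G.maxDegree :=
    mul_pos (by linarith) (Nat.cast_pos.2 hΔ)
  obtain ⟨w, hw⟩ := card_pos.1 (Nat.cast_pos.1 (h_pos.trans_le h_both))
  simp only [mem_inter, mem_filter] at hw
  have hwl := H.isSimilar_of_isClose hl.1 hw.1.2.2
  have hwm := H.isSimilar_of_isClose hm.1 hw.2.2
  exact (hwl.symm.trans hwm).mono (by linarith)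

lemma half_le_iff_isSimilar (H : GoodEstimates G δ lead est) (hΔ : 0 < G.maxDegree)
    (hδ : δ ≤ 1 / 26) (hl : IsActive G δ lead est l)
    (hm : IsActive G δ lead est m) (hv : IsClose G δ est v l) :
    (G.maxDegree : ℝ) / 2 ≤ est v m ↔ IsSimilar G (8 * δ) l m := by
  have hvl := H.isSimilar_of_isClose hl.1 hv
  constructor <;> intro h
  · have hvm : IsSimilar G (1 / 2 + δ) v m := H.isSimilar_of_le hm.1 (by linarith)
    exact H.isSimilar_of_isActive hΔ (by linarith) hl hm (hvl.symm.trans hvm)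
  · refine (H.le_of_isSimilar hm.1 (hvl.trans h)).trans' ?_
    nlinarith [(Nat.cast_nonneg G.maxDegree : (0 : ℝ) ≤ _)]

/-- Among active leaders `8δ`-similarity is transitive, so each cluster is the set of vertices
close to the leaders of one similarity class. -/
lemma clusterLabel_eq_iff (H : GoodEstimates G δ lead est) (hΔ : 0 < G.maxDegree)
    (hδ₀ : 0 ≤ δ) (hδ : δ ≤ 1 / 26) {ident : V → ℕ} (h_ident : Function.Injective ident)
    (hl : IsActive G δ lead est l) (hv : IsClose G δ est v l)
    (hm : IsActive G δ lead est m) (hu : IsClose G δ est u m) :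
    clusterLabel G δ lead est ident v = clusterLabel G δ lead est ident u ↔
      IsSimilar G (8 * δ) l m := by
  let S (x : V) : Set V := {l | IsActive G δ lead est l ∧ (G.maxDegree : ℝ) / 2 ≤ est x l}
  have mem_S {x k j} (hk : IsActive G δ lead est k) (hx : IsClose G δ est x k) :
      j ∈ S x ↔ IsActive G δ lead est j ∧ IsSimilar G (8 * δ) k j :=
    and_congr_right fun hj ↦ H.half_le_iff_isSimilar hΔ hδ hk hj hx
  have trans {i j k} (hi : IsActive G δ lead est i) (hk : IsActive G δ lead est k)
      (hij : IsSimilar G (8 * δ) i j) (hjk : IsSimilar G (8 * δ) j k) :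
      IsSimilar G (8 * δ) i k :=
    H.isSimilar_of_isActive hΔ (by linarith) hi hk (hij.trans hjk)
  have sInf_mem {x k} (hk : IsActive G δ lead est k) (hx : IsClose G δ est x k) :
      sInf (ident '' S x) ∈ ident '' S x :=
    Nat.sInf_mem ⟨_, Set.mem_image_of_mem _
      ((mem_S hk hx).2 ⟨hk, hk.isSimilar_self.mono (by linarith)⟩)⟩
  rw [clusterLabel, clusterLabel, if_pos ⟨l, hl, hv⟩, if_pos ⟨m, hm, hu⟩, Option.some_inj]
  constructor <;> intro h
  · obtain ⟨j, hj, hj_eq⟩ := sInf_mem hl hv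
    obtain ⟨k, hk, hk_eq⟩ := sInf_mem hm hu
    obtain rfl : j = k := h_ident ((hj_eq.trans h).trans hk_eq.symm)
    exact trans hl hm ((mem_S hl hv).1 hj).2 ((mem_S hm hu).1 hk).2.symm
  · congr 2
    ext j
    rw [mem_S hl hv, mem_S hm hu]
    exact and_congr_right fun hj ↦ ⟨trans hm hj h.symm, trans hl hj h⟩

theorem outputsACD_clusterLabel (H : GoodEstimates G δ lead est) (hΔ : 0 < G.maxDegree)
    (hδ₀ : 0 ≤ δ) (hδ : δ ≤ 1 / 26) {ε : ℝ} (hε : 24 * δ ≤ ε) {ident : V → ℕ}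
    (h_ident : Function.Injective ident) :
    OutputsACD G ε δ (clusterLabel G δ lead est ident) := by
  classical
  have exists_leader {v} (hv : clusterLabel G δ lead est ident v ≠ none) :
      ∃ l, IsActive G δ lead est l ∧ IsClose G δ est v l := by
    by_contra h
    exact hv (if_neg h)
  refine outputsACD_of_forall (fun v hv hdense ↦ ?_) (fun v hv ↦ ?_) fun v hv ↦ ?_
  · rw [clusterLabel, if_pos (H.exists_isActive_isClose hδ₀ hdense)] at hv
    cases hv
  · obtain ⟨l, hl, hvl⟩ := exists_leader hv
    have isSimilar_leader : ∀ u ∈ univ.filter fun u ↦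
        clusterLabel G δ lead est ident u = clusterLabel G δ lead est ident v,
        IsSimilar G (12 * δ) u l := fun u hu ↦ by
      rw [mem_filter_univ] at hu
      obtain ⟨m, hm, hum⟩ := exists_leader (hu ▸ hv)
      have hml := (H.clusterLabel_eq_iff hΔ hδ₀ hδ h_ident hm hum hl hvl).1 hu
      exact ((H.isSimilar_of_isClose hm.1 hum).trans hml).mono (by linarith)
    have h_card := card_mul_le_of_forall_isSimilar hΔ isSimilar_leader
    calc _ ≤ (1 + 24 * δ) * (#_ * (1 - 12 * δ)) := by
          rw [mul_left_comm]
          exact le_mul_of_one_le_right (Nat.cast_nonneg _) (by nlinarith)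
      _ ≤ (1 + ε) * G.maxDegree :=
          mul_le_mul (by linarith) h_card (mul_nonneg (Nat.cast_nonneg _) (by linarith))
            (by linarith)
  · obtain ⟨l, hl, hvl⟩ := exists_leader hv
    have h_close : (1 - (4 * δ + 2 * δ)) * G.maxDegree ≤ (#(_ ∩ _) : ℝ) :=
      le_card_inter_of_subset_neighborFinset inter_subset_right (filter_subset _ _)
        (H.isSimilar_of_isClose hl.1 hvl) hl.2
    calc (1 - ε) * G.maxDegree ≤ (1 - (4 * δ + 2 * δ)) * G.maxDegree := by gcongr; linarith
      _ ≤ _ := h_close.trans (Nat.cast_le.2 (card_le_card fun w hw ↦ ?_))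
    simp only [mem_inter, mem_filter] at hw ⊢
    exact ⟨hw.1.1, (H.clusterLabel_eq_iff hΔ hδ₀ hδ h_ident hl hw.2.2 hl hvl).2
      (hl.isSimilar_self.mono (by linarith))⟩

end GoodEstimates

end Clustering

section Messages

/-- The bit string that carries a message. A leading bit separates the message `0` from silence,
which has to be the empty string. -/
def encodeMessage : Option ℕ → List Bool
  | none => []
  | some i => true :: i.bits

lemma encodeMessage_injective : Function.Injective encodeMessage := by
  have bits_injective : Function.Injective Nat.bits := fun i j hij ↦
    Nat.eq_of_testBit_eq fun b ↦ by rw [Nat.testBit_eq_inth, Nat.testBit_eq_inth, hij]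
  rintro (_ | i) (_ | j) h
  · rfl
  · cases h
  · cases h
  · exact congrArg some (bits_injective (List.cons.inj h).2)

lemma length_encodeMessage_le {n a : ℕ} (hn : 2 ≤ n) {m : Option ℕ} (hm : ∀ i ∈ m, i < n ^ a) :
    (encodeMessage m).length ≤ (a + 1) * Nat.clog 2 n := by
  cases m with
  | none => exact Nat.zero_le _
  | some i =>
    have h_size : i.size ≤ a * Nat.clog 2 n := Nat.size_le.2 <| calc
      i < n ^ a := hm i rfl
      _ ≤ (2 ^ Nat.clog 2 n) ^ a := Nat.pow_le_pow_left (Nat.le_pow_clog one_lt_two n) a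
      _ = 2 ^ (a * Nat.clog 2 n) := by rw [← pow_mul, mul_comm]
    have h_clog : 0 < Nat.clog 2 n := Nat.clog_pos one_lt_two hn
    rw [encodeMessage, List.length_cons, Nat.size_eq_bits_len, add_one_mul]
    omega

/-- The inverse of `encodeMessage`, arbitrary on bit strings that carry no message. -/
noncomputable def decodeMessage : List Bool → Option ℕ :=
  Function.invFun encodeMessage

lemma decodeMessage_encodeMessage (m : Option ℕ) : decodeMessage (encodeMessage m) = m :=
  Function.leftInverse_invFun encodeMessage_injective m

/-- The messages that a node receives in one round, by port. -/
abbrev Inbox : Type :=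
  ℕ → Option ℕ

namespace Labelling

variable {V : Type} [Fintype V] [DecidableEq V] {G : SimpleGraph V} [DecidableRel G.Adj]
  {idBound : ℕ} (L : Labelling G idBound)

/-- The inbox of `v` when each neighbour `u` sends it the message `f u`. -/
def collect (v : V) (f : G.neighborSet v → Option ℕ) : Inbox :=
  fun p ↦ if h : p < G.degree v then f ((L.port v).symm ⟨p, h⟩) else none

variable {v : V} {f : G.neighborSet v → Option ℕ}

lemma collect_port (u : G.neighborSet v) : L.collect v f (L.port v u) = f u := by
  simp [collect]

lemma exists_port_of_collect_ne_none {p : ℕ} (h : L.collect v f p ≠ none) :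
    ∃ u, (L.port v u : ℕ) = p := by
  by_cases hp : p < G.degree v
  · exact ⟨(L.port v).symm ⟨p, hp⟩, by simp⟩
  · exact absurd (dif_neg hp) h

lemma exists_collect_eq_some_iff {i : ℕ} :
    (∃ p, L.collect v f p = some i) ↔ ∃ u, f u = some i := by
  constructor
  · rintro ⟨p, hp⟩
    obtain ⟨u, rfl⟩ := L.exists_port_of_collect_ne_none (hp ▸ Option.some_ne_none i)
    exact ⟨u, (L.collect_port u).symm.trans hp⟩
  · rintro ⟨u, hu⟩
    exact ⟨L.port v u, (L.collect_port u).trans hu⟩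

open Classical in
lemma ncard_collect {Q : Option ℕ → Prop} {R : V → Prop} (h_none : ¬ Q none)
    (hQR : ∀ u, Q (f u) ↔ R u) :
    {p | Q (L.collect v f p)}.ncard = #{u ∈ G.neighborFinset v | R u} := by
  rw [← Set.ncard_coe_finset]
  refine (Set.ncard_congr (fun u hu ↦ (L.port v ⟨u, ?_⟩ : ℕ)) ?_ ?_ ?_).symm
  · simpa using (mem_filter.1 hu).1
  · intro u hu
    rw [Set.mem_ofPred_eq, collect_port, hQR]
    exact (mem_filter.1 hu).2
  · intro u w _ _ huw
    simpa using Fin.val_injective huw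
  · intro p hp
    obtain ⟨u, rfl⟩ := L.exists_port_of_collect_ne_none fun h ↦ h_none (h ▸ hp)
    rw [Set.mem_ofPred_eq, collect_port, hQR] at hp
    exact ⟨u, by simpa using ⟨u.2, hp⟩, rfl⟩

end Labelling

end Messages

/-- A distributed algorithm in a form that is convenient to analyse: messages are natural numbers
or silence, and the behaviour of a node is a function of its initial knowledge and of the list of
all its inboxes so far. -/
structure Protocol where
  Knowledge : Type
  numBits : ℕ → ℕ → ℕ
  initial : (n Δ ident degree : ℕ) → (Fin (numBits n Δ) → Bool) → Knowledge
  message : Knowledge → List Inbox → (port : ℕ) → Option ℕ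
  output : Knowledge → List Inbox → Option ℕ

namespace Protocol

variable (P : Protocol)

/-- The algorithm that runs `P` on bit strings. -/
noncomputable abbrev toDistAlgorithm : DistAlgorithm where
  State := P.Knowledge × List Inbox
  numBits := P.numBits
  init n Δ ident degree coins := (P.initial n Δ ident degree coins, [])
  send s p := encodeMessage (P.message s.1 s.2 p)
  receive s m := (s.1, s.2 ++ [fun p ↦ decodeMessage (m p)])
  output s := P.output s.1 s.2

variable {V : Type} [Fintype V] [DecidableEq V] {G : SimpleGraph V} [DecidableRel G.Adj]
  {idBound : ℕ} (L : Labelling G idBound)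

/-- The inboxes of each node in the first `t` rounds, given the initial knowledge of all nodes. -/
def history (know : V → P.Knowledge) : ℕ → V → List Inbox
  | 0 => fun _ ↦ []
  | t + 1 => fun v ↦ history know t v ++ [L.collect v fun u ↦
      P.message (know u) (history know t u) (L.port u ⟨v, G.adj_symm u.2⟩)]

/-- The initial knowledge of each node. -/
def knowledge (ω : P.toDistAlgorithm.Coins G) (v : V) : P.Knowledge :=
  P.initial (Fintype.card V) G.maxDegree (L.ident v) (G.degree v) (ω v)

lemma run_toDistAlgorithm (ω : P.toDistAlgorithm.Coins G) (t : ℕ) (v : V) :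
    P.toDistAlgorithm.run L ω t v = (P.knowledge L ω v, P.history L (P.knowledge L ω) t v) := by
  induction t generalizing v with
  | zero => rfl
  | succ t ih =>
    have h_inbox (p : ℕ) :
        decodeMessage (P.toDistAlgorithm.inbox L (P.toDistAlgorithm.run L ω t) v p) =
          L.collect v (fun u ↦ P.message (P.knowledge L ω u)
            (P.history L (P.knowledge L ω) t u) (L.port u ⟨v, G.adj_symm u.2⟩)) p := by
      unfold DistAlgorithm.inbox Labelling.collect
      split_ifs
      · simp only [ih, decodeMessage_encodeMessage]
      · exact decodeMessage_encodeMessage none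
    simp only [DistAlgorithm.run, history, ← funext h_inbox]
    rw [ih]

/-- Nodes only send their own identifier or a value they have received. -/
def IsForwarding : Prop :=
  ∀ n Δ ident degree coins h p, ∀ i ∈ P.message (P.initial n Δ ident degree coins) h p,
    i = ident ∨ ∃ r ∈ h, ∃ q, r q = some i

variable {P}

lemma IsForwarding.lt_of_mem_history (hP : P.IsForwarding) (ω : P.toDistAlgorithm.Coins G)
    {t : ℕ} {v : V} {r : Inbox} (hr : r ∈ P.history L (P.knowledge L ω) t v) {q i : ℕ}
    (hi : r q = some i) : i < idBound := by
  induction t generalizing v r q with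
  | zero => cases hr
  | succ t ih =>
    rcases List.mem_append.1 hr with hr | hr
    · exact ih hr hi
    · obtain rfl := List.mem_singleton.1 hr
      obtain ⟨u, hu⟩ := L.exists_collect_eq_some_iff.1 ⟨q, hi⟩
      rcases hP _ _ _ _ _ _ _ i hu with rfl | ⟨r, hr, q, hq⟩
      · exact L.ident_lt _
      · exact ih hr hq

theorem IsForwarding.isCongest (hP : P.IsForwarding) (T a : ℕ) :
    P.toDistAlgorithm.IsCongest T a (a + 1) := by
  intro V _ _ G _ L ω t v p _
  have h_card : 2 ≤ Fintype.card V := (Nat.succ_le_of_lt p.pos).trans_lt (G.degree_lt_card_verts v)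
  rw [run_toDistAlgorithm]
  refine length_encodeMessage_le h_card fun i hi ↦ ?_
  rcases hP _ _ _ _ _ _ _ i hi with rfl | ⟨r, hr, q, hq⟩
  · exact L.ident_lt v
  · exact hP.lt_of_mem_history L ω hr hq

end Protocol

open Classical in
/-- The element of `S` that is preceded by exactly `k` elements of `S`, if there is one. -/
noncomputable def nthElement (S : Set ℕ) (k : ℕ) : Option ℕ :=
  if h : ∃ i ∈ S, Nat.count (· ∈ S) i = k then some h.choose else none

open Classical in
lemma nthElement_eq_some_iff {S : Set ℕ} {k i : ℕ} :
    nthElement S k = some i ↔ i ∈ S ∧ Nat.count (· ∈ S) i = k := by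
  rw [nthElement]
  split_ifs with h
  · refine ⟨fun hi ↦ Option.some_injective _ hi ▸ h.choose_spec, fun hi ↦ congrArg some ?_⟩
    exact Nat.count_injective h.choose_spec.1 hi.1 (h.choose_spec.2.trans hi.2.symm)
  · exact ⟨nofun, fun hi ↦ absurd ⟨i, hi⟩ h⟩

/-- A vertex is a leader with probability `2 ^ (-leadBits Δ)`, which is about `1 / √Δ`. -/
def leadBits (Δ : ℕ) : ℕ :=
  Nat.log 4 Δ

/-- The number of slots for the votes of a vertex, about `8√Δ`: enough for every leader among its
neighbours to get one with high probability. -/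
def numSlots (Δ : ℕ) : ℕ :=
  2 ^ (leadBits Δ + 3)

section Voting

variable {V : Type} [Fintype V] [DecidableEq V] (G : SimpleGraph V) [DecidableRel G.Adj]

open Classical in
/-- The number of leaders adjacent to `w` that precede `l` in the order of identifiers. -/
noncomputable def leaderRank (ident : V → ℕ) (lead : V → Prop) (w l : V) : ℕ :=
  Nat.count (· ∈ ident '' {u | G.Adj w u ∧ lead u}) (ident l)

/-- The vertex `w` votes for its neighbouring leader `l` if the rank of `l` is the slot of `w`. -/
def Votes (ident : V → ℕ) (lead : V → Prop) (slot : V → ℕ) (w l : V) : Prop :=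
  G.Adj w l ∧ lead l ∧ leaderRank G ident lead w l = slot w

open Classical in
/-- The estimate of the number of common neighbours of `u` and `l`. A common neighbour `w` of them
votes for `l` if its slot takes one particular value among `numSlots Δ`. -/
noncomputable def voteEstimate (ident : V → ℕ) (lead : V → Prop) (slot : V → ℕ) (u l : V) : ℝ :=
  numSlots G.maxDegree * #{w ∈ G.neighborFinset u | Votes G ident lead slot w l}

end Voting

/-- What a vertex starts from in the voting protocol. -/
structure VoterKnowledge where
  maxDegree : ℕ
  ident : ℕ
  isLeader : Prop
  slot : ℕ

/-- The identifiers received in a round. -/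
def Inbox.heard (r : Inbox) : Set ℕ :=
  {i | ∃ p, r p = some i}

namespace VoterKnowledge

variable (k : VoterKnowledge)

/-- The estimate of the number of neighbours shared with the leader `i`, when `r` contains the
votes of the neighbours. -/
noncomputable def estimate (r : Inbox) (i : ℕ) : ℝ :=
  numSlots k.maxDegree * {p | r p = some i}.ncard

open Classical in
/-- The message sent through port `p` after the inboxes listed. In turn: the leaders introduce
themselves; everyone votes; everyone replies to the leaders to which it is close; the active leaders
announce themselves; the votes for active leaders are repeated. -/
noncomputable def message (δ : ℝ) : List Inbox → (p : ℕ) → Option ℕ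
  | [], _ => if k.isLeader then some k.ident else none
  | [r₀], _ => nthElement r₀.heard k.slot
  | [r₀, r₁], p => (r₀ p).filter fun i ↦ (1 - 3 * δ) * k.maxDegree ≤ k.estimate r₁ i
  | [_, _, r₂], _ =>
      if k.isLeader ∧ (1 - 2 * δ) * k.maxDegree ≤ {p | r₂ p ≠ none}.ncard then some k.ident
      else none
  | [r₀, _, _, r₃], _ => (nthElement r₀.heard k.slot).filter (· ∈ r₃.heard)
  | _, _ => none

open Classical in
/-- The label chosen on the basis of the repeated votes, as in `clusterLabel`. -/
noncomputable def label (δ : ℝ) : List Inbox → Option ℕ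
  | [_, _, _, _, r₄] =>
      if ∃ i, (1 - 3 * δ) * k.maxDegree ≤ k.estimate r₄ i then
        some (sInf {i | (k.maxDegree : ℝ) / 2 ≤ k.estimate r₄ i})
      else none
  | _ => none

lemma mem_heard_of_mem_message {δ : ℝ} {h : List Inbox} {p i : ℕ} (hi : i ∈ k.message δ h p) :
    i = k.ident ∨ ∃ r ∈ h, i ∈ r.heard := by
  unfold message at hi
  split at hi
  · split_ifs at hi
    · exact .inl (Option.some_injective _ hi).symm
    · cases hi
  · exact .inr ⟨_, by simp, (nthElement_eq_some_iff.1 hi).1⟩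
  · exact .inr ⟨_, List.mem_cons_self, p, (Option.filter_eq_some_iff.1 hi).1⟩
  · split_ifs at hi
    · exact .inl (Option.some_injective _ hi).symm
    · cases hi
  · exact .inr ⟨_, List.mem_cons_self,
      (nthElement_eq_some_iff.1 (Option.filter_eq_some_iff.1 hi).1).1⟩
  · cases hi

end VoterKnowledge

/-- A string of `m` bits read as a number below `2 ^ m`. -/
def bitsEquivFin (m : ℕ) : (Fin m → Bool) ≃ Fin (2 ^ m) :=
  (Equiv.arrowCongr (Equiv.refl _) finTwoEquiv.symm).trans finFunctionFinEquiv

/-- The protocol for the almost-clique decomposition. A vertex is a leader if its first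
`leadBits Δ` bits vanish, and its other bits make up its slot. -/
noncomputable def votingProtocol (δ : ℝ) : Protocol where
  Knowledge := VoterKnowledge
  numBits _ Δ := leadBits Δ + (leadBits Δ + 3)
  initial _ Δ ident _ coins :=
    { maxDegree := Δ
      ident := ident
      isLeader := ∀ j, coins (Fin.castAdd _ j) = false
      slot := bitsEquivFin _ fun j ↦ coins (Fin.natAdd _ j) }
  message k := k.message δ
  output k := k.label δ

lemma isForwarding_votingProtocol (δ : ℝ) : (votingProtocol δ).IsForwarding :=
  fun _ _ _ _ _ _ _ _ ↦ VoterKnowledge.mem_heard_of_mem_message _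

section VotingSemantics

variable {V : Type} [Fintype V] [DecidableEq V] {G : SimpleGraph V} [DecidableRel G.Adj]
  {idBound : ℕ} (L : Labelling G idBound) (δ : ℝ) (lead : V → Prop) (slot : V → ℕ)

/-- The initial knowledge that corresponds to the given leaders and slots. -/
def voterKnowledge (v : V) : VoterKnowledge where
  maxDegree := G.maxDegree
  ident := L.ident v
  isLeader := lead v
  slot := slot v

/-- The message that `u` sends through port `p` in round `t` of the voting protocol, with rounds
counted from `0`. -/
noncomputable def sent (t : ℕ) (u : V) (p : ℕ) : Option ℕ :=
  (voterKnowledge L lead slot u).message δ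
    ((votingProtocol δ).history L (voterKnowledge L lead slot) t u) p

/-- The inbox of `v` in round `t`. -/
noncomputable def received (t : ℕ) (v : V) : Inbox :=
  L.collect v fun u ↦ sent L δ lead slot t u (L.port u ⟨v, G.adj_symm u.2⟩)

variable {L δ lead slot}

lemma mem_heard_received_iff {t i : ℕ} {R : V → Prop}
    (h : ∀ u p, sent L δ lead slot t u p = some i ↔ R u) (v : V) :
    i ∈ (received L δ lead slot t v).heard ↔ ∃ u, G.Adj v u ∧ R u := by
  refine L.exists_collect_eq_some_iff.trans ?_
  simp only [h, Subtype.exists, SimpleGraph.mem_neighborSet, exists_prop]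

open Classical in
lemma estimate_received {t i : ℕ} {R : V → Prop}
    (h : ∀ u p, sent L δ lead slot t u p = some i ↔ R u) (v : V) :
    (voterKnowledge L lead slot v).estimate (received L δ lead slot t v) i =
      numSlots G.maxDegree * #{u ∈ G.neighborFinset v | R u} := by
  rw [VoterKnowledge.estimate]
  congr 2
  exact L.ncard_collect (Q := (· = some i)) nofun fun u ↦ h u _

lemma heard_received_zero (w : V) :
    (received L δ lead slot 0 w).heard = L.ident '' {u | G.Adj w u ∧ lead u} := by
  classical
  ext i
  have h_sent (u : V) (p : ℕ) :
      sent L δ lead slot 0 u p = some i ↔ lead u ∧ L.ident u = i := by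
    change (if lead u then some (L.ident u) else none) = some i ↔ _
    rw [Option.ite_none_right_eq_some, Option.some_inj]
  simp [mem_heard_received_iff h_sent, and_assoc]

lemma nthElement_heard_eq_some_iff {w : V} {i : ℕ} :
    nthElement (received L δ lead slot 0 w).heard (slot w) = some i ↔
      ∃ l, Votes G L.ident lead slot w l ∧ L.ident l = i := by
  rw [nthElement_eq_some_iff, heard_received_zero]
  constructor
  · rintro ⟨⟨l, hl, rfl⟩, h_count⟩
    exact ⟨l, ⟨hl.1, hl.2, h_count⟩, rfl⟩
  · rintro ⟨l, ⟨hwl, hl, h_count⟩, rfl⟩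
    exact ⟨⟨l, ⟨hwl, hl⟩, rfl⟩, h_count⟩

lemma sent_one_eq_some_ident_iff (w : V) (p : ℕ) (l : V) :
    sent L δ lead slot 1 w p = some (L.ident l) ↔ Votes G L.ident lead slot w l := by
  have h_sent : sent L δ lead slot 1 w p =
      nthElement (received L δ lead slot 0 w).heard (slot w) := rfl
  rw [h_sent, nthElement_heard_eq_some_iff]
  refine ⟨?_, fun h ↦ ⟨l, h, rfl⟩⟩
  rintro ⟨m, hm, hml⟩
  exact L.ident_injective hml ▸ hm

lemma sent_two_ne_none_iff {u l : V} (hl : lead l) (hul : l ∈ G.neighborSet u) :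
    sent L δ lead slot 2 u (L.port u ⟨l, hul⟩) ≠ none ↔
      IsClose G δ (voteEstimate G L.ident lead slot) u l := by
  have h_intro : received L δ lead slot 0 u (L.port u ⟨l, hul⟩) = some (L.ident l) :=
    (L.collect_port _).trans (if_pos hl)
  have h_sent : sent L δ lead slot 2 u (L.port u ⟨l, hul⟩) =
      (received L δ lead slot 0 u (L.port u ⟨l, hul⟩)).filter fun i ↦
        (1 - 3 * δ) * (G.maxDegree : ℝ) ≤
          (voterKnowledge L lead slot u).estimate (received L δ lead slot 1 u) i := rfl
  rw [h_sent, h_intro, Option.filter_some,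
    estimate_received fun w p ↦ sent_one_eq_some_ident_iff w p l]
  simp [IsClose, voteEstimate]

lemma sent_three_eq_some_iff (l : V) (p i : ℕ) :
    sent L δ lead slot 3 l p = some i ↔
      IsActive G δ lead (voteEstimate G L.ident lead slot) l ∧ L.ident l = i := by
  classical
  have h_replies (hl : lead l) : {p | received L δ lead slot 2 l p ≠ none}.ncard =
      #{u ∈ G.neighborFinset l | IsClose G δ (voteEstimate G L.ident lead slot) u l} :=
    L.ncard_collect (Q := (· ≠ none)) (not_not_intro rfl) fun _ ↦ sent_two_ne_none_iff hl _
  have h_sent : sent L δ lead slot 3 l p =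
      if lead l ∧ (1 - 2 * δ) * (G.maxDegree : ℝ) ≤
        {p | received L δ lead slot 2 l p ≠ none}.ncard then some (L.ident l) else none := rfl
  rw [h_sent, IsActive, Option.ite_none_right_eq_some, Option.some_inj]
  exact and_congr_left fun _ ↦ and_congr_right fun hl ↦ by rw [h_replies hl]

lemma sent_four_eq_some_iff (w : V) (p i : ℕ) :
    sent L δ lead slot 4 w p = some i ↔ ∃ l, Votes G L.ident lead slot w l ∧
      IsActive G δ lead (voteEstimate G L.ident lead slot) l ∧ L.ident l = i := by
  classical
  have h_sent : sent L δ lead slot 4 w p =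
      (nthElement (received L δ lead slot 0 w).heard (slot w)).filter
        (· ∈ (received L δ lead slot 3 w).heard) := rfl
  rw [h_sent, Option.filter_eq_some_iff, nthElement_heard_eq_some_iff, decide_eq_true_iff,
    mem_heard_received_iff (fun l p ↦ sent_three_eq_some_iff l p i)]
  constructor
  · rintro ⟨⟨l, hwl, rfl⟩, m, -, hm, hml⟩
    exact ⟨l, hwl, L.ident_injective hml ▸ hm, rfl⟩
  · rintro ⟨l, hwl, hl, rfl⟩
    exact ⟨⟨l, hwl, rfl⟩, l, hwl.1, hl, rfl⟩

lemma le_estimate_received_four_iff {v : V} {x : ℝ} (hx : 0 < x) {i : ℕ} :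
    x ≤ (voterKnowledge L lead slot v).estimate (received L δ lead slot 4 v) i ↔
      ∃ l, (IsActive G δ lead (voteEstimate G L.ident lead slot) l ∧
        x ≤ voteEstimate G L.ident lead slot v l) ∧ L.ident l = i := by
  classical
  rw [estimate_received fun w p ↦ sent_four_eq_some_iff w p i]
  by_cases h_active : ∃ l, IsActive G δ lead (voteEstimate G L.ident lead slot) l ∧ L.ident l = i
  · obtain ⟨l, hl, rfl⟩ := h_active
    have h_unique {Q : V → Prop} : (∃ m, Q m ∧ L.ident m = L.ident l) ↔ Q l := by
      simp only [L.ident_injective.eq_iff, exists_eq_right]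
    simp only [← and_assoc, h_unique, hl, and_true, true_and, voteEstimate]
  · have h_none (Q : V → Prop) : ¬ ∃ l, Q l ∧
        IsActive G δ lead (voteEstimate G L.ident lead slot) l ∧ L.ident l = i :=
      fun ⟨l, _, hl⟩ ↦ h_active ⟨l, hl⟩
    simp only [h_none, filter_false, card_empty, Nat.cast_zero, mul_zero, hx.not_ge, false_iff]
    exact fun ⟨l, hl, hli⟩ ↦ h_active ⟨l, hl.1, hli⟩

theorem label_history (hΔ : 0 < G.maxDegree) (hδ : δ < 1 / 3) (v : V) :
    (voterKnowledge L lead slot v).label δ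
      ((votingProtocol δ).history L (voterKnowledge L lead slot) 5 v) =
    clusterLabel G δ lead (voteEstimate G L.ident lead slot) L.ident v := by
  classical
  have h_half : (0 : ℝ) < G.maxDegree / 2 := half_pos (Nat.cast_pos.2 hΔ)
  have h_close : 0 < (1 - 3 * δ) * (G.maxDegree : ℝ) :=
    mul_pos (by linarith) (Nat.cast_pos.2 hΔ)
  have h_label : (voterKnowledge L lead slot v).label δ
      ((votingProtocol δ).history L (voterKnowledge L lead slot) 5 v) =
      if ∃ i, (1 - 3 * δ) * (G.maxDegree : ℝ) ≤
          (voterKnowledge L lead slot v).estimate (received L δ lead slot 4 v) i then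
        some (sInf {i | (G.maxDegree : ℝ) / 2 ≤
          (voterKnowledge L lead slot v).estimate (received L δ lead slot 4 v) i})
      else none := rfl
  simp only [h_label, le_estimate_received_four_iff h_close, le_estimate_received_four_iff h_half]
  exact if_congr ⟨fun ⟨_, l, hl, _⟩ ↦ ⟨l, hl⟩, fun ⟨l, hl⟩ ↦ ⟨_, l, hl, rfl⟩⟩ rfl rfl

end VotingSemantics

section Concentration

open MeasureTheory ProbabilityTheory

variable {Ω : Type*} [MeasurableSpace Ω] {μ : Measure Ω} [IsProbabilityMeasure μ]

lemma exp_mul_le_one_add_mul {x τ : ℝ} (hx : x ∈ Set.Icc 0 1) (hτ : |τ| ≤ 1) :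
    Real.exp (τ * x) ≤ 1 + (τ + τ ^ 2) * x := by
  have h_abs : |τ * x| ≤ 1 := by
    rw [abs_mul, abs_of_nonneg hx.1]
    exact mul_le_one₀ hτ hx.1 hx.2
  have h_exp := (abs_le.1 (Real.abs_exp_sub_one_sub_id_le h_abs)).2
  have h_sq : τ ^ 2 * x ^ 2 ≤ τ ^ 2 * x := by
    gcongr
    exact pow_le_of_le_one hx.1 hx.2 two_ne_zero
  linarith [mul_pow τ x 2]

lemma mgf_le_exp_of_mem_Icc {X : Ω → ℝ} (hX : Measurable X) (h_mem : ∀ ω, X ω ∈ Set.Icc 0 1)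
    {τ : ℝ} (hτ : |τ| ≤ 1) : mgf X μ τ ≤ Real.exp ((τ + τ ^ 2) * μ[X]) := by
  have h_int : Integrable X μ := .of_mem_Icc 0 1 hX.aemeasurable (.of_forall h_mem)
  calc mgf X μ τ ≤ ∫ ω, (1 + (τ + τ ^ 2) * X ω) ∂μ :=
        integral_mono (integrable_exp_mul_of_mem_Icc hX.aemeasurable (.of_forall h_mem))
          ((integrable_const 1).add (h_int.const_mul _))
          fun ω ↦ exp_mul_le_one_add_mul (h_mem ω) hτ
    _ = (τ + τ ^ 2) * μ[X] + 1 := by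
        rw [integral_add (integrable_const 1) (h_int.const_mul _), integral_const_mul]
        simp [add_comm]
    _ ≤ _ := Real.add_one_le_exp _

variable {ι : Type*} {X : ι → Ω → ℝ} {S : Finset ι} {s τ : ℝ}

lemma mgf_sum_le_exp_of_mem_Icc (h_indep : iIndepFun X μ) (hX : ∀ i, Measurable (X i))
    (h_mem : ∀ i ω, X i ω ∈ Set.Icc 0 1) (hτ : |τ| ≤ 1) :
    mgf (∑ i ∈ S, X i) μ τ ≤ Real.exp ((τ + τ ^ 2) * ∑ i ∈ S, μ[X i]) := by
  rw [h_indep.mgf_sum hX, mul_sum, Real.exp_sum]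
  exact prod_le_prod (fun _ _ ↦ mgf_nonneg) fun i _ ↦ mgf_le_exp_of_mem_Icc (hX i) (h_mem i) hτ

/-- Unlike in Hoeffding's inequality, the variance term is proportional to the mean. This matters
because the means here are of smaller order than the number of summands. -/
theorem measureReal_le_abs_sum_sub_le (h_indep : iIndepFun X μ) (hX : ∀ i, Measurable (X i))
    (h_mem : ∀ i ω, X i ω ∈ Set.Icc 0 1) (hτ₀ : 0 ≤ τ) (hτ₁ : τ ≤ 1) :
    μ.real {ω | s ≤ |∑ i ∈ S, X i ω - ∑ i ∈ S, μ[X i]|} ≤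
      2 * Real.exp (τ ^ 2 * (∑ i ∈ S, μ[X i]) - τ * s) := by
  set N := ∑ i ∈ S, μ[X i]
  have h_int (t : ℝ) : Integrable (fun ω ↦ Real.exp (t * (∑ i ∈ S, X i) ω)) μ :=
    h_indep.integrable_exp_mul_sum hX fun i _ ↦
      integrable_exp_mul_of_mem_Icc (hX i).aemeasurable (.of_forall (h_mem i))
  have h_upper : μ.real {ω | N + s ≤ (∑ i ∈ S, X i) ω} ≤ Real.exp (τ ^ 2 * N - τ * s) := by
    refine (measure_ge_le_exp_mul_mgf _ hτ₀ (h_int τ)).trans ?_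
    grw [mgf_sum_le_exp_of_mem_Icc h_indep hX h_mem (abs_le.2 ⟨by linarith, hτ₁⟩), ← Real.exp_add]
    exact (congrArg _ (by ring)).le
  have h_lower : μ.real {ω | (∑ i ∈ S, X i) ω ≤ N - s} ≤ Real.exp (τ ^ 2 * N - τ * s) := by
    refine (measure_le_le_exp_mul_mgf _ (neg_nonpos.2 hτ₀) (h_int (-τ))).trans ?_
    grw [mgf_sum_le_exp_of_mem_Icc h_indep hX h_mem
      (abs_le.2 ⟨neg_le_neg hτ₁, by linarith⟩), ← Real.exp_add]
    exact (congrArg _ (by ring)).le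
  calc _ ≤ μ.real ({ω | N + s ≤ (∑ i ∈ S, X i) ω} ∪ {ω | (∑ i ∈ S, X i) ω ≤ N - s}) := by
        refine measureReal_mono fun ω (hω : s ≤ |_|) ↦ ?_
        simp only [Set.mem_union, Set.mem_ofPred_eq, Finset.sum_apply]
        exact (le_abs.1 hω).imp (fun h ↦ by linarith) fun h ↦ by linarith
    _ ≤ _ := by
        grw [measureReal_union_le, h_upper, h_lower, two_mul]

end Concentration

section UniformMeasure

open MeasureTheory ProbabilityTheory

lemma uniformOn_univ_real_preimage_equiv {Ω Ω' : Type*} [Finite Ω] [MeasurableSpace Ω]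
    [MeasurableSingletonClass Ω] [Finite Ω'] [MeasurableSpace Ω'] [MeasurableSingletonClass Ω']
    (e : Ω ≃ Ω') (s : Set Ω') :
    (uniformOn (Set.univ : Set Ω)).real (e ⁻¹' s) = (uniformOn (Set.univ : Set Ω')).real s := by
  cases nonempty_fintype Ω
  cases nonempty_fintype Ω'
  simp only [measureReal_def, uniformOn_univ, Fintype.card_congr e,
    Measure.count_apply (Set.toFinite _).measurableSet,
    Set.encard_preimage_of_bijective e.bijective]

lemma uniformOn_univ_prod {α β : Type*} [Finite α] [MeasurableSpace α]
    [MeasurableSingletonClass α] [Finite β] [MeasurableSpace β] [MeasurableSingletonClass β] :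
    uniformOn (Set.univ : Set (α × β)) =
      (uniformOn (Set.univ : Set α)).prod (uniformOn (Set.univ : Set β)) := by
  cases nonempty_fintype α
  cases nonempty_fintype β
  refine Measure.ext_of_singleton fun x ↦ ?_
  rw [← Set.singleton_prod_singleton, Measure.prod_prod, Set.singleton_prod_singleton]
  simp only [uniformOn_univ, Measure.count_singleton, Fintype.card_prod, Nat.cast_mul, one_div]
  exact ENNReal.mul_inv (.inr (ENNReal.natCast_ne_top _)) (.inl (ENNReal.natCast_ne_top _))

lemma uniformOn_univ_real_preimage_fst {α β : Type*} [Finite α] [MeasurableSpace α]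
    [MeasurableSingletonClass α] [Finite β] [Nonempty β] [MeasurableSpace β]
    [MeasurableSingletonClass β] (s : Set α) :
    (uniformOn (Set.univ : Set (α × β))).real (Prod.fst ⁻¹' s) =
      (uniformOn (Set.univ : Set α)).real s := by
  rw [uniformOn_univ_prod]
  exact measurePreserving_fst.measureReal_preimage (Set.toFinite s).measurableSet.nullMeasurableSet

lemma measureReal_prod_le_of_forall {α β : Type*} [MeasurableSpace α] [MeasurableSpace β]
    {μ : Measure α} {ν : Measure β} [IsProbabilityMeasure μ] [IsFiniteMeasure ν]
    {s : Set (α × β)} (hs : MeasurableSet s) {c : ℝ} (h : ∀ a, ν.real (Prod.mk a ⁻¹' s) ≤ c) :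
    (μ.prod ν).real s ≤ c := by
  have hc : 0 ≤ c := measureReal_nonneg.trans (h (nonempty_of_isProbabilityMeasure μ).some)
  refine ENNReal.toReal_le_of_le_ofReal hc ?_
  calc μ.prod ν s ≤ ∫⁻ a, ν (Prod.mk a ⁻¹' s) ∂μ := Measure.prod_apply_le hs
    _ ≤ ∫⁻ _, ENNReal.ofReal c ∂μ := lintegral_mono fun a ↦
        (ENNReal.le_ofReal_iff_toReal_le (measure_ne_top _ _) hc).2 (h a)
    _ = ENNReal.ofReal c := by simp

lemma measureReal_exists_le_card_mul {ι Ω : Type*} [Fintype ι] [MeasurableSpace Ω]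
    {μ : Measure Ω} {E : ι → Ω → Prop} {b : ℝ} (h : ∀ i, μ.real {ω | E i ω} ≤ b) :
    μ.real {ω | ∃ i, E i ω} ≤ Fintype.card ι * b :=
  calc μ.real {ω | ∃ i, E i ω} = μ.real (⋃ i, {ω | E i ω}) := by rw [Set.ofPred_exists]
    _ ≤ ∑ i, μ.real {ω | E i ω} := measureReal_iUnion_fintype_le _
    _ ≤ ∑ _ : ι, b := sum_le_sum fun i _ ↦ h i
    _ = Fintype.card ι * b := by simp

variable {ι γ : Type*} [Finite ι] [Fintype γ] [MeasurableSpace γ] [MeasurableSingletonClass γ]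
  {S : Finset ι}

theorem uniformOn_univ_real_le_abs_card_filter_eq_sub_le [DecidableEq γ] [Nonempty γ]
    (y : ι → γ) {s τ : ℝ} (hτ₀ : 0 ≤ τ) (hτ₁ : τ ≤ 1) :
    (uniformOn (Set.univ : Set (ι → γ))).real
        {x | s ≤ |(#{i ∈ S | x i = y i} : ℝ) - #S / Fintype.card γ|} ≤
      2 * Real.exp (τ ^ 2 * (#S / Fintype.card γ) - τ * s) := by
  cases nonempty_fintype ι
  have h_pi : uniformOn (Set.univ : Set (ι → γ)) = Measure.pi fun _ ↦ uniformOn Set.univ := by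
    rw [← uniformOn_pi, Set.pi_univ]
  let X (i : ι) (z : γ) : ℝ := if z = y i then 1 else 0
  have h_indep : iIndepFun (fun i (x : ι → γ) ↦ X i (x i)) (uniformOn Set.univ) :=
    h_pi ▸ iIndepFun_pi fun i ↦ (measurable_of_finite (X i)).aemeasurable
  have h_mean (i : ι) : ∫ x : ι → γ, X i (x i) ∂uniformOn Set.univ = 1 / Fintype.card γ := by
    have h_indicator : X i = Set.indicator {y i} 1 := by
      ext z
      simp [X, Set.indicator_apply]
    rw [h_pi, integral_comp_eval (measurable_of_finite (X i)).aestronglyMeasurable, h_indicator,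
      integral_indicator_one (measurableSet_singleton _), measureReal_def, uniformOn_univ,
      Measure.count_singleton, ENNReal.toReal_div, ENNReal.toReal_one, ENNReal.toReal_natCast]
  have h_tail := measureReal_le_abs_sum_sub_le (S := S) (s := s) h_indep
    (fun i ↦ measurable_of_finite _) (fun i x ↦ by dsimp only [X]; split_ifs <;> simp) hτ₀ hτ₁
  simpa [h_mean, X, div_eq_mul_inv] using h_tail

lemma uniformOn_univ_real_lt_card_filter_eq_le [DecidableEq γ] (hS : #S ≤ 4 * Fintype.card γ ^ 2)
    (c : γ) :
    (uniformOn (Set.univ : Set (ι → γ))).real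
        {x | 8 * Fintype.card γ < #{i ∈ S | x i = c}} ≤
      2 * Real.exp (-Fintype.card γ) := by
  have : Nonempty γ := ⟨c⟩
  have hγ : (0 : ℝ) < Fintype.card γ := Nat.cast_pos.2 Fintype.card_pos
  have h_mean : (#S : ℝ) / Fintype.card γ ≤ 4 * Fintype.card γ := by
    rw [div_le_iff₀ hγ]
    exact_mod_cast (hS.trans_eq (by ring))
  calc _ ≤ (uniformOn (Set.univ : Set (ι → γ))).real
        {x | 4 * (Fintype.card γ : ℝ) ≤
          |(#{i ∈ S | x i = c} : ℝ) - #S / Fintype.card γ|} := by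
        refine measureReal_mono fun x (hx : 8 * Fintype.card γ < _) ↦ ?_
        have hx' : (8 * Fintype.card γ : ℝ) < #{i ∈ S | x i = c} := by exact_mod_cast hx
        rw [Set.mem_ofPred_eq]
        exact le_abs.2 (.inl (by linarith))
    _ ≤ _ := uniformOn_univ_real_le_abs_card_filter_eq_sub_le (fun _ ↦ c) one_half_pos.le
        one_half_lt_one.le
    _ ≤ _ := by
        gcongr
        linarith

lemma uniformOn_univ_real_forall_ne_le (c : γ) :
    (uniformOn (Set.univ : Set (ι → γ))).real {x | ∀ i ∈ S, x i ≠ c} ≤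
      2 * Real.exp (-(#S / Fintype.card γ) / 4) := by
  classical
  have : Nonempty γ := ⟨c⟩
  calc _ ≤ (uniformOn (Set.univ : Set (ι → γ))).real
        {x | (#S : ℝ) / Fintype.card γ ≤
          |(#{i ∈ S | x i = c} : ℝ) - #S / Fintype.card γ|} := by
        refine measureReal_mono fun x (hx : ∀ i ∈ S, x i ≠ c) ↦ ?_
        rw [Set.mem_ofPred_eq, filter_false_of_mem hx, card_empty, Nat.cast_zero, zero_sub, abs_neg]
        exact le_abs_self _
    _ ≤ _ := uniformOn_univ_real_le_abs_card_filter_eq_sub_le (fun _ ↦ c) one_half_pos.le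
        one_half_lt_one.le
    _ = _ := by
        ring_nf

lemma uniformOn_univ_real_lt_abs_mul_card_filter_eq_sub_le [DecidableEq γ] [Nonempty γ]
    (y : ι → γ) {δ D : ℝ} (hδ₀ : 0 ≤ δ) (hδ₁ : δ ≤ 1) (hS : #S ≤ D) :
    (uniformOn (Set.univ : Set (ι → γ))).real
        {x | δ * D < |(Fintype.card γ : ℝ) * #{i ∈ S | x i = y i} - #S|} ≤
      2 * Real.exp (-(δ ^ 2 * D / (4 * Fintype.card γ))) := by
  have hγ : (0 : ℝ) < Fintype.card γ := Nat.cast_pos.2 Fintype.card_pos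
  calc _ ≤ (uniformOn (Set.univ : Set (ι → γ))).real
        {x | δ * D / Fintype.card γ ≤
          |(#{i ∈ S | x i = y i} : ℝ) - #S / Fintype.card γ|} := by
        refine measureReal_mono fun x (hx : δ * D < |_|) ↦ ?_
        rw [Set.mem_ofPred_eq, div_le_iff₀' hγ, ← abs_of_pos hγ, ← abs_mul, abs_of_pos hγ,
          mul_sub, mul_div_cancel₀ _ hγ.ne']
        exact hx.le
    _ ≤ 2 * Real.exp ((δ / 2) ^ 2 * (#S / Fintype.card γ) -
          δ / 2 * (δ * D / Fintype.card γ)) :=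
        uniformOn_univ_real_le_abs_card_filter_eq_sub_le y (by linarith) (by linarith)
    _ ≤ 2 * Real.exp ((δ / 2) ^ 2 * (D / Fintype.card γ) -
          δ / 2 * (δ * D / Fintype.card γ)) := by
        gcongr
    _ = _ := by
        congr 2
        field_simp
        ring

end UniformMeasure

section RandomVotes

open MeasureTheory ProbabilityTheory

instance (Δ : ℕ) : NeZero (numSlots Δ) :=
  ⟨(Nat.two_pow_pos _).ne'⟩

lemma numSlots_eq (Δ : ℕ) : numSlots Δ = 8 * 2 ^ leadBits Δ := by
  rw [numSlots]
  ring

lemma two_pow_leadBits_sq (Δ : ℕ) : (2 ^ leadBits Δ) ^ 2 = 4 ^ leadBits Δ := by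
  rw [← pow_mul, mul_comm, pow_mul]
  norm_num

lemma two_pow_leadBits_sq_le {Δ : ℕ} (hΔ : 0 < Δ) : (2 ^ leadBits Δ) ^ 2 ≤ Δ :=
  (two_pow_leadBits_sq Δ).trans_le (Nat.pow_log_le_self 4 hΔ.ne')

lemma le_four_mul_two_pow_leadBits_sq (Δ : ℕ) : Δ ≤ 4 * (2 ^ leadBits Δ) ^ 2 := by
  rw [two_pow_leadBits_sq, ← pow_succ']
  exact (Nat.lt_pow_succ_log_self (by norm_num) Δ).le

variable {V : Type} [Fintype V] {G : SimpleGraph V} [DecidableRel G.Adj] {ident : V → ℕ}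
  {lead : V → Prop} {δ : ℝ}

lemma leaderRank_lt_card [DecidablePred lead] {w l : V} (hwl : G.Adj w l) (hl : lead l) :
    leaderRank G ident lead w l < #{u ∈ G.neighborFinset w | lead u} := by
  classical
  have h_finite : (ident '' {u | G.Adj w u ∧ lead u}).Finite := Set.toFinite _
  calc leaderRank G ident lead w l < #h_finite.toFinset :=
        Nat.count_lt_card (p := (· ∈ ident '' {u | G.Adj w u ∧ lead u})) h_finite
          ⟨l, ⟨hwl, hl⟩, rfl⟩
    _ = #(({u ∈ G.neighborFinset w | lead u} : Finset V).image ident) := by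
        congr 1
        ext i
        simp
    _ ≤ _ := card_image_le

variable {α : Type*} [MeasurableSpace α] [MeasurableSingletonClass α] (c : α)

lemma uniformOn_univ_real_exists_numSlots_lt_card_le [Fintype α] [DecidableEq α]
    (hα : Fintype.card α = 2 ^ leadBits G.maxDegree) (hδ₀ : 0 ≤ δ) (hδ₁ : δ ≤ 1) :
    (uniformOn (Set.univ : Set (V → α))).real
        {x | ∃ w, numSlots G.maxDegree < #{l ∈ G.neighborFinset w | x l = c}} ≤
      Fintype.card V * (2 * Real.exp (-(δ ^ 2 / 32 * 2 ^ leadBits G.maxDegree))) := by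
  refine measureReal_exists_le_card_mul fun w ↦ ?_
  have h_degree : #(G.neighborFinset w) ≤ 4 * Fintype.card α ^ 2 := by
    rw [hα]
    exact (G.degree_le_maxDegree w).trans (le_four_mul_two_pow_leadBits_sq _)
  have h_tail := uniformOn_univ_real_lt_card_filter_eq_le h_degree c
  rw [hα, ← numSlots_eq] at h_tail
  refine h_tail.trans ?_
  push_cast
  gcongr
  exact mul_le_of_le_one_left (by positivity) (by nlinarith)

variable [DecidableEq V]

lemma voteEstimate_of_lead {slot : V → ℕ} {l : V} (hl : lead l) (u : V) :
    voteEstimate G ident lead slot u l = numSlots G.maxDegree *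
      #{w ∈ G.neighborFinset u ∩ G.neighborFinset l | slot w = leaderRank G ident lead w l} := by
  rw [voteEstimate]
  congr 3
  ext w
  simp [Votes, hl, G.adj_comm w l, eq_comm (a := slot w), and_assoc]

lemma uniformOn_univ_real_voteEstimate_le [DecidablePred lead] (hΔ : 0 < G.maxDegree)
    (h_few : ∀ w, #{l ∈ G.neighborFinset w | lead l} ≤ numSlots G.maxDegree)
    (hδ₀ : 0 ≤ δ) (hδ₁ : δ ≤ 1) {l : V} (hl : lead l) (u : V) :
    (uniformOn (Set.univ : Set (V → Fin (numSlots G.maxDegree)))).real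
        {y | δ * G.maxDegree < |voteEstimate G ident lead (fun v ↦ y v) u l -
          #(G.neighborFinset u ∩ G.neighborFinset l)|} ≤
      2 * Real.exp (-(δ ^ 2 / 32 * 2 ^ leadBits G.maxDegree)) := by
  have h_slot (y : V → Fin (numSlots G.maxDegree)) {w : V}
      (hw : w ∈ G.neighborFinset u ∩ G.neighborFinset l) :
      (y w : ℕ) = leaderRank G ident lead w l ↔
        y w = Fin.ofNat (numSlots G.maxDegree) (leaderRank G ident lead w l) := by
    have hwl : G.Adj w l := G.adj_symm ((G.mem_neighborFinset l w).1 (mem_inter.1 hw).2)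
    rw [Fin.ext_iff, Fin.val_ofNat,
      Nat.mod_eq_of_lt ((leaderRank_lt_card hwl hl).trans_le (h_few w))]
  have h_codegree : (#(G.neighborFinset u ∩ G.neighborFinset l) : ℝ) ≤ G.maxDegree :=
    Nat.cast_le.2 ((card_le_card inter_subset_left).trans (G.degree_le_maxDegree u))
  have h_tail := uniformOn_univ_real_lt_abs_mul_card_filter_eq_sub_le
    (fun w ↦ Fin.ofNat (numSlots G.maxDegree) (leaderRank G ident lead w l)) hδ₀ hδ₁ h_codegree
  have h_rate : δ ^ 2 / 32 * 2 ^ leadBits G.maxDegree ≤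
      δ ^ 2 * G.maxDegree / (4 * numSlots G.maxDegree) := by
    have h_sq : ((2 : ℝ) ^ leadBits G.maxDegree) ^ 2 ≤ G.maxDegree := by
      exact_mod_cast two_pow_leadBits_sq_le hΔ
    rw [numSlots_eq, le_div_iff₀ (by positivity)]
    push_cast
    linear_combination δ ^ 2 * h_sq
  simp only [Fintype.card_fin] at h_tail
  simp only [voteEstimate_of_lead hl, filter_congr fun _ hw ↦ h_slot _ hw]
  grw [h_tail, h_rate]

lemma uniformOn_univ_real_exists_isDense_forall_ne_le [Fintype α]
    (hα : Fintype.card α = 2 ^ leadBits G.maxDegree) (hΔ : 0 < G.maxDegree) (hδ₀ : 0 ≤ δ)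
    (hδ₁ : δ ≤ 1 / 2) :
    (uniformOn (Set.univ : Set (V → α))).real
        {x | ∃ u, IsDense G δ u ∧ ∀ l, IsFriend G δ u l → x l ≠ c} ≤
      Fintype.card V * (2 * Real.exp (-(δ ^ 2 / 32 * 2 ^ leadBits G.maxDegree))) := by
  classical
  refine measureReal_exists_le_card_mul fun u ↦ ?_
  by_cases hu : IsDense G δ u
  swap
  · simp [hu, Real.exp_nonneg]
  have h_tail := uniformOn_univ_real_forall_ne_le (S := {l | IsFriend G δ u l}) c
  have h_sq : ((2 : ℝ) ^ leadBits G.maxDegree) ^ 2 ≤ G.maxDegree := by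
    exact_mod_cast two_pow_leadBits_sq_le hΔ
  have h_mean : 1 / 2 * (2 : ℝ) ^ leadBits G.maxDegree ≤
      #{l | IsFriend G δ u l} / 2 ^ leadBits G.maxDegree := by
    rw [le_div_iff₀ (by positivity)]
    calc 1 / 2 * (2 : ℝ) ^ leadBits G.maxDegree * 2 ^ leadBits G.maxDegree
        = 1 / 2 * ((2 : ℝ) ^ leadBits G.maxDegree) ^ 2 := by ring
      _ ≤ (1 - δ) * G.maxDegree := by gcongr <;> linarith
      _ ≤ _ := by
        unfold IsDense at hu
        convert hu
  have h_rate : δ ^ 2 / 32 * (2 : ℝ) ^ leadBits G.maxDegree ≤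
      1 / 8 * 2 ^ leadBits G.maxDegree :=
    mul_le_mul_of_nonneg_right (by nlinarith) (by positivity)
  simp only [mem_filter_univ, hα, Nat.cast_pow, Nat.cast_ofNat] at h_tail
  simp only [hu, true_and]
  refine h_tail.trans ?_
  gcongr
  linarith

lemma uniformOn_univ_real_exists_voteEstimate_le [Finite α] [DecidableEq α]
    (hΔ : 0 < G.maxDegree) (hδ₀ : 0 ≤ δ) (hδ₁ : δ ≤ 1) :
    (uniformOn (Set.univ : Set ((V → α) × (V → Fin (numSlots G.maxDegree))))).real
        {p | ∃ e : V × V, p.1 e.2 = c ∧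
          (∀ w, #{l ∈ G.neighborFinset w | p.1 l = c} ≤ numSlots G.maxDegree) ∧
          δ * G.maxDegree < |voteEstimate G ident (fun v ↦ p.1 v = c) (fun v ↦ p.2 v) e.1 e.2 -
            #(G.neighborFinset e.1 ∩ G.neighborFinset e.2)|} ≤
      Fintype.card (V × V) * (2 * Real.exp (-(δ ^ 2 / 32 * 2 ^ leadBits G.maxDegree))) := by
  have : Nonempty α := ⟨c⟩
  refine measureReal_exists_le_card_mul fun e ↦ ?_
  rw [uniformOn_univ_prod]
  refine measureReal_prod_le_of_forall (Set.toFinite _).measurableSet fun x ↦ ?_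
  rw [Set.preimage_ofPred_eq]
  by_cases hx : x e.2 = c ∧ ∀ w, #{l ∈ G.neighborFinset w | x l = c} ≤ numSlots G.maxDegree
  · simpa only [hx, true_and, implies_true] using
      uniformOn_univ_real_voteEstimate_le hΔ hx.2 hδ₀ hδ₁ hx.1 e.1
  · simp only [← and_assoc, hx, false_and]
    simp [Real.exp_nonneg]

theorem uniformOn_univ_real_not_goodEstimates_le [Fintype α]
    (hα : Fintype.card α = 2 ^ leadBits G.maxDegree) (hΔ : 0 < G.maxDegree) (hδ₀ : 0 ≤ δ)
    (hδ₁ : δ ≤ 1 / 2) :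
    (uniformOn (Set.univ : Set ((V → α) × (V → Fin (numSlots G.maxDegree))))).real
        {p | ¬ GoodEstimates G δ (fun v ↦ p.1 v = c)
          (voteEstimate G ident (fun v ↦ p.1 v = c) fun v ↦ p.2 v)} ≤
      (4 * Fintype.card V + 2 * Fintype.card V ^ 2) *
        Real.exp (-(δ ^ 2 / 32 * 2 ^ leadBits G.maxDegree)) := by
  classical
  have : Nonempty α := ⟨c⟩
  let crowded : Set (V → α) :=
    {x | ∃ w, numSlots G.maxDegree < #{l ∈ G.neighborFinset w | x l = c}}
  let leaderless : Set (V → α) := {x | ∃ u, IsDense G δ u ∧ ∀ l, IsFriend G δ u l → x l ≠ c}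
  let misjudged : Set ((V → α) × (V → Fin (numSlots G.maxDegree))) :=
    {p | ∃ e : V × V, p.1 e.2 = c ∧
      (∀ w, #{l ∈ G.neighborFinset w | p.1 l = c} ≤ numSlots G.maxDegree) ∧
      δ * G.maxDegree < |voteEstimate G ident (fun v ↦ p.1 v = c) (fun v ↦ p.2 v) e.1 e.2 -
        #(G.neighborFinset e.1 ∩ G.neighborFinset e.2)|}
  set r := Real.exp (-(δ ^ 2 / 32 * 2 ^ leadBits G.maxDegree))
  calc _ ≤ (uniformOn Set.univ).real
          (Prod.fst ⁻¹' crowded ∪ Prod.fst ⁻¹' leaderless ∪ misjudged) := by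
        refine measureReal_mono fun p hp ↦ ?_
        by_contra h_bad
        obtain ⟨h_lead, h_est⟩ := not_or.1 h_bad
        obtain ⟨h_crowded, h_leaderless⟩ := not_or.1 h_lead
        refine hp ⟨fun u l hl ↦ not_lt.1 fun h ↦ h_est
          ⟨(u, l), hl, fun w ↦ not_lt.1 fun hw ↦ h_crowded ⟨w, hw⟩, h⟩, fun u hu ↦ ?_⟩
        by_contra! h_none
        exact h_leaderless ⟨u, hu, fun l hul hl ↦ h_none l hl hul⟩
    _ ≤ Fintype.card V * (2 * r) + Fintype.card V * (2 * r) + Fintype.card (V × V) * (2 * r) := by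
        grw [measureReal_union_le, measureReal_union_le,
          uniformOn_univ_real_preimage_fst, uniformOn_univ_real_preimage_fst,
          uniformOn_univ_real_exists_numSlots_lt_card_le c hα hδ₀ (by linarith),
          uniformOn_univ_real_exists_isDense_forall_ne_le c hα hΔ hδ₀ hδ₁,
          uniformOn_univ_real_exists_voteEstimate_le c hΔ hδ₀ (by linarith)]
    _ = _ := by
        rw [Fintype.card_prod]
        push_cast
        ring

end RandomVotes

section Main

open MeasureTheory ProbabilityTheory

variable {V : Type} [Fintype V] [DecidableEq V] {G : SimpleGraph V} [DecidableRel G.Adj]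
  {idBound : ℕ} (L : Labelling G idBound)

/-- The random bits of the vertices, split into those that select the leaders and the slots made up
of the others. -/
def splitCoins (G : SimpleGraph V) [DecidableRel G.Adj] (δ : ℝ) :
    (votingProtocol δ).toDistAlgorithm.Coins G ≃
      (V → Fin (leadBits G.maxDegree) → Bool) × (V → Fin (numSlots G.maxDegree)) :=
  ((Equiv.refl V).arrowCongr ((Fin.appendEquiv _ _).symm.trans
    ((Equiv.refl _).prodCongr (bitsEquivFin _)))).trans (Equiv.arrowProdEquivProdArrow V _ _)

lemma output_votingProtocol {δ : ℝ} (hΔ : 0 < G.maxDegree) (hδ : δ < 1 / 3)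
    (ω : (votingProtocol δ).toDistAlgorithm.Coins G) :
    (fun v ↦ (votingProtocol δ).toDistAlgorithm.output
        ((votingProtocol δ).toDistAlgorithm.run L ω 5 v)) =
      clusterLabel G δ (fun w ↦ (splitCoins G δ ω).1 w = fun _ ↦ false)
        (voteEstimate G L.ident (fun w ↦ (splitCoins G δ ω).1 w = fun _ ↦ false)
          fun w ↦ (splitCoins G δ ω).2 w) L.ident := by
  have h_knowledge : (votingProtocol δ).knowledge L ω =
      voterKnowledge L (fun w ↦ (splitCoins G δ ω).1 w = fun _ ↦ false)
        fun w ↦ (splitCoins G δ ω).2 w := by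
    funext w
    simp only [voterKnowledge, funext_iff]
    rfl
  funext v
  rw [Protocol.run_toDistAlgorithm, h_knowledge]
  exact label_history hΔ hδ v

theorem one_sub_le_outputProb_votingProtocol {δ ε : ℝ} (hΔ : 0 < G.maxDegree) (hδ₀ : 0 ≤ δ)
    (hδ : δ ≤ 1 / 26) (hε : 24 * δ ≤ ε) :
    1 - (4 * Fintype.card V + 2 * Fintype.card V ^ 2) *
        Real.exp (-(δ ^ 2 / 32 * 2 ^ leadBits G.maxDegree)) ≤
      (votingProtocol δ).toDistAlgorithm.outputProb L 5 (OutputsACD G ε δ) := by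
  let bad : Set ((V → Fin (leadBits G.maxDegree) → Bool) × (V → Fin (numSlots G.maxDegree))) :=
    {p | ¬ GoodEstimates G δ (fun v ↦ p.1 v = fun _ ↦ false)
      (voteEstimate G L.ident (fun v ↦ p.1 v = fun _ ↦ false) fun v ↦ p.2 v)}
  calc _ ≤ 1 - (uniformOn Set.univ).real bad := by
        grw [uniformOn_univ_real_not_goodEstimates_le _ (by simp) hΔ hδ₀ (by linarith)]
    _ = (uniformOn Set.univ).real (splitCoins G δ ⁻¹' bad)ᶜ := by
        rw [probReal_compl_eq_one_sub (Set.toFinite _).measurableSet,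
          uniformOn_univ_real_preimage_equiv]
    _ ≤ _ := by
        refine measureReal_mono fun ω hω ↦ ?_
        rw [Set.mem_ofPred_eq, output_votingProtocol L hΔ (by linarith)]
        exact (not_not.1 hω).outputsACD_clusterLabel hΔ hδ₀ hδ hε L.ident_injective

lemma mul_exp_neg_le_rpow_neg {n r κ : ℝ} (hn : 2 ≤ n) (h : (κ + 4) * Real.log n ≤ r) :
    (4 * n + 2 * n ^ 2) * Real.exp (-r) ≤ n ^ (-κ) := by
  have hn₀ : 0 < n := by linarith
  have h_poly : 4 * n + 2 * n ^ 2 ≤ n ^ 4 := by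
    have h_factor : 0 ≤ n * (n - 2) * (n ^ 2 + 2 * n + 2) :=
      mul_nonneg (mul_nonneg hn₀.le (by linarith)) (by positivity)
    linear_combination h_factor
  calc (4 * n + 2 * n ^ 2) * Real.exp (-r)
      ≤ n ^ 4 * Real.exp (-((κ + 4) * Real.log n)) := by gcongr
    _ = n ^ (4 : ℝ) * n ^ (-(κ + 4)) := by
        rw [Real.rpow_def_of_pos hn₀ (-(κ + 4)), mul_comm (Real.log n), neg_mul]
        norm_cast
    _ = n ^ (-κ) := by
        rw [← Real.rpow_add hn₀]
        congr 1
        ring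

lemma mul_log_le_two_pow_leadBits {K n : ℝ} {Δ : ℕ}
    (h : ((2 * K) ^ 2 + 1) * Real.log n ^ 2 ≤ Δ) : K * Real.log n ≤ 2 ^ leadBits Δ := by
  refine (le_abs_self _).trans (abs_le_of_sq_le_sq ?_ (by positivity))
  have h_sq : (Δ : ℝ) ≤ 4 * (2 ^ leadBits Δ) ^ 2 := by
    exact_mod_cast le_four_mul_two_pow_leadBits_sq Δ
  linarith [sq_nonneg (Real.log n)]

theorem mainTheorem6_general :
    ∃ T : ℕ, ∀ ε η : ℝ, 0 < η → η ≤ 1 / 26 → 24 * η ≤ ε →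
      ∃ A : DistAlgorithm, (∀ a : ℕ, ∃ B : ℕ, A.IsCongest T a B) ∧
        ∀ κ : ℝ, ∃ c : ℝ, 0 < c ∧
          ∀ (V : Type) [Fintype V] [DecidableEq V] (G : SimpleGraph V) [DecidableRel G.Adj]
            {idBound : ℕ} (L : Labelling G idBound),
            c * Real.log (Fintype.card V) ^ 2 ≤ (G.maxDegree : ℝ) →
            1 - (Fintype.card V : ℝ) ^ (-κ) ≤ A.outputProb L T (OutputsACD G ε η) := by
  refine ⟨5, fun ε η hη₀ hη hε ↦ ⟨(votingProtocol η).toDistAlgorithm,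
    fun a ↦ ⟨a + 1, (isForwarding_votingProtocol η).isCongest 5 a⟩,
    fun κ ↦ ⟨(2 * (32 * (κ + 4) / η ^ 2)) ^ 2 + 1, by positivity, fun V _ _ G _ _ L h ↦ ?_⟩⟩⟩
  obtain h_card | h_card | h_card :
      Fintype.card V = 0 ∨ Fintype.card V = 1 ∨ 2 ≤ Fintype.card V := by omega
  · have : IsEmpty V := Fintype.card_eq_zero_iff.1 h_card
    have h_output (out : V → Option ℕ) : OutputsACD G ε η out :=
      outputsACD_of_forall isEmptyElim isEmptyElim isEmptyElim
    simp only [DistAlgorithm.outputProb, h_output, Set.ofPred_true, probReal_univ]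
    exact sub_le_self 1 (by positivity)
  · rw [h_card, Nat.cast_one, Real.one_rpow, sub_self]
    exact measureReal_nonneg
  · have h_two : (2 : ℝ) ≤ Fintype.card V := Nat.ofNat_le_cast.2 h_card
    have h_log : 0 < Real.log (Fintype.card V) := Real.log_pos (by linarith)
    have hΔ : 0 < G.maxDegree := Nat.cast_pos.1 (lt_of_lt_of_le (by positivity) h)
    have h_rate : (κ + 4) * Real.log (Fintype.card V) ≤ η ^ 2 / 32 * 2 ^ leadBits G.maxDegree := by
      grw [← mul_log_le_two_pow_leadBits h]
      exact (by field_simp : _ = _).le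
    grw [← one_sub_le_outputProb_votingProtocol L hΔ hη₀.le hη hε,
      mul_exp_neg_le_rpow_neg h_two h_rate]

end Main

theorem mainTheorem6 :
    ∃ T : ℕ, ∀ a : ℕ, ∃ (A : DistAlgorithm) (B : ℕ), A.IsCongest T a B ∧
      ∀ κ : ℝ, 1 ≤ κ → ∃ c : ℝ, 0 < c ∧
        ∀ (V : Type) [Fintype V] [DecidableEq V] (G : SimpleGraph V) [DecidableRel G.Adj]
          (L : Labelling G (Fintype.card V ^ a)),
          c * Real.log (Fintype.card V) ^ 2 ≤ (G.maxDegree : ℝ) →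
          1 - (Fintype.card V : ℝ) ^ (-κ) ≤
            A.outputProb L T (OutputsACD G (1 / 3) (1 / 3 / 108)) := by
  obtain ⟨T, hT⟩ := mainTheorem6_general
  obtain ⟨A, hA, h⟩ := hT (1 / 3) (1 / 3 / 108) (by norm_num) (by norm_num) (by norm_num)
  refine ⟨T, fun a ↦ ?_⟩
  obtain ⟨B, hB⟩ := hA a
  refine ⟨A, B, hB, fun κ _ ↦ ?_⟩
  obtain ⟨c, hc, h⟩ := h κ
  exact ⟨c, hc, fun V _ _ G _ L ↦ h V G L⟩
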